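/- Let $U_2$ be a real orthogonal (i.e. unitary with real entries) finite matrix whose $1$-eigenspace is spanned by a single real unit vector $|\phi_0\rangle$, let $|\mu\rangle$ be a real unit vector, and put $U=U_2(I-2|\mu\rangle\langle\mu|)$ and $|\widetilde\phi_0\rangle=|\phi_0\rangle-\langle\mu|\phi_0\rangle|\mu\rangle$ (not normalized). For an eigenvalue $\mathrm e^{\mathrm i\alpha}$ of $U$ with $\alpha\in(-\pi,\pi]$ let $p_\alpha$ be the squared norm of the orthogonal projection of $|\widetilde\phi_0\rangle$ to its eigenspace. Let $\mathit{QH}$ take the value $1/|\alpha|$ (the value $0$ if $\alpha=0$) with weight $p_\alpha$, for each eigenvalue; the weights sum to $\|\widetilde\phi_0\|^2\le 1$. For $0<\varepsilon<1$ put $$\mathsf{QHT}_\varepsilon(U_2,|\mu\rangle)=\min\{y\ge 0:\Pr[\mathit{QH}>y]\le\varepsilon\}.$$ For $0<\Delta\le 1$ let $\mathbf{Estimate}$ be the standard phase estimation circuit for $U$ with precision $\Delta$: it uses $t=\lceil\log_2(2\pi/\Delta)\rceil$ ancilla qubits initialized to $|0\rangle$, and it consists of Hadamard gates on all ancilla qubits,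 $2^q$ applications of $U$ controlled by qubit $q$ for $q=0,\dots,t-1$, the inverse quantum Fourier transform on the ancilla, and a measurement of the ancilla; the outcome $y\in\{0,\dots,2^t-1\}$ is read as the phase $2\pi y/2^t$, reduced modulo $2\pi$ to $(-\pi,\pi]$. Fix a constant $c\ge 1/\ln 3$. The procedure $\mathbf{Detect}(U,\Delta,\varepsilon)$ applies $\mathbf{Estimate}$ with precision $\Delta$ successively $\lceil c\ln(1/\varepsilon)\rceil$ times to the same system register, with fresh ancilla qubits each time, and accepts if and only if at least one of the estimated phases is nonzero. On an unnormalized input, the probability of a list of outcomes is the squared norm of the resulting unnormalized final state. **Theorem.** There is a constant $K>0$, depending only on $c$, such that for all $U_2$, $|\mu\rangle$, $|\phi_0\rangle$ as above, every $0<\varepsilon<1$ and every real $T\ge\max\{1,\mathsf{QHT}_\varepsilon(U_2,|\mu\rangle)\}$ the following holds. 1. If $\langle\phi_0|\mu\rangle\ne 0$, then $\mathbf{Detect}(U,1/T,\varepsilon)$ accepts $|\widetilde\phi_0\rangle$ with a probability between $\|\widetilde\phi_0\|^2-K\varepsilon$ and $\|\widetilde\phi_0\|^2$. 2. If $\langle\phi_0|\mu\rangle=0$,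 then $\mathbf{Detect}(U,1/T,\varepsilon)$ accepts $|\widetilde\phi_0\rangle$ with probability $0$. 3. The number of applications of controlled-$U$ made by $\mathbf{Detect}(U,1/T,\varepsilon)$ is at most $K(1+\ln(1/\varepsilon))\,T$, and at most $K\ln(1/\varepsilon)\,T$ if $\varepsilon\le 1/2$. -/

import Mathlib

open scoped InnerProductSpace

noncomputable section

/-! ### Circuits with black-box access to a controlled operator

A circuit acts on `t` ancilla qubits together with a system register whose state space is `E`.
A joint (unnormalized) state is given by its components `⟨b| ⊗ id`, one vector of `E` for each
basis state `b` of the ancilla. -/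

/-- Gates: a Hadamard gate on an ancilla qubit, one application of the black-box operator
to the system controlled by an ancilla qubit, and the inverse quantum Fourier transform on the
whole ancilla register. -/
inductive QGate (t : ℕ) where
  | hadamard (q : Fin t) : QGate t
  | controlledU (q : Fin t) : QGate t
  | inverseQFT : QGate t

/-- Joint states of `t` qubits and a system with state space `E`. -/
abbrev JointState (t : ℕ) (E : Type*) := (Fin t → Bool) → E

/-- The integer in `{0, …, 2 ^ t - 1}` with binary digits `b` (`b j` has weight `2 ^ j`). -/
def bitsValue {t : ℕ} (b : Fin t → Bool) : ℕ :=
  ∑ j : Fin t, if b j then 2 ^ (j : ℕ) else 0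

section Semantics

variable {E : Type*} [NormedAddCommGroup E] [InnerProductSpace ℂ E]

/-- Action of a gate on joint states, when the black-box operator is `U`. -/
def QGate.apply {t : ℕ} (U : Module.End ℂ E) : QGate t → JointState t E → JointState t E
  | .hadamard q, s => fun b =>
      ((1 / Real.sqrt 2 : ℝ) : ℂ) •
        (s (Function.update b q false) +
          (if b q then (-1 : ℂ) else 1) • s (Function.update b q true))
  | .controlledU q, s => fun b => if b q then U (s b) else s b
  | .inverseQFT, s => fun b =>
      ((1 / Real.sqrt (2 ^ t) : ℝ) : ℂ) •
        ∑ b' : Fin t → Bool,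
          Complex.exp (-(2 * Real.pi * Complex.I * (bitsValue b : ℂ) * (bitsValue b' : ℂ) / 2 ^ t))
            • s b'

/-- A circuit is a sequence of gates, executed from left to right. -/
abbrev QCircuit (t : ℕ) := List (QGate t)

/-- Execution of a circuit. -/
def QCircuit.run {t : ℕ} (U : Module.End ℂ E) : QCircuit t → JointState t E → JointState t E
  | [], s => s
  | g :: C, s => QCircuit.run U C (g.apply U s)

/-- The joint state `|0…0⟩ ⊗ ψ`. -/
def initState (t : ℕ) (ψ : E) : JointState t E :=
  fun b => if b = fun _ => false then ψ else 0

/-- `1` for an application of the controlled black-box operator, `0` for the other gates. -/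
def QGate.cost {t : ℕ} : QGate t → ℕ
  | .controlledU _ => 1
  | _ => 0

/-- The number of applications of the controlled black-box operator in a circuit. -/
def QCircuit.controlledUCount {t : ℕ} (C : QCircuit t) : ℕ := (C.map QGate.cost).sum

/-! ### Procedures: circuits with intermediate measurements -/

/-- A procedure with `t` ancilla qubits: its circuits are executed one after the other on the same
system register, each of them with the ancilla freshly initialized to `|0…0⟩` and followed by a
measurement of the ancilla in the computational basis. At the end the procedure accepts or rejects
according to the list of the measurement outcomes. -/
structure QProcedure where
  t : ℕ
  rounds : List (QCircuit t)
  accepts : List (Fin t → Bool) → Prop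

open Classical in
/-- Probability that the outcome list, extending the earlier outcomes `hist`, satisfies `acc`.
States are unnormalized: after outcome `b` the system is left in the component `b` of the joint
state, and the squared norm of the final vector is the probability of the whole outcome list. -/
def acceptProbAux {t : ℕ} (U : Module.End ℂ E) (acc : List (Fin t → Bool) → Prop) :
    List (QCircuit t) → List (Fin t → Bool) → E → ℝ
  | [], hist, ψ => if acc hist then ‖ψ‖ ^ 2 else 0
  | C :: Cs, hist, ψ =>
      ∑ b : Fin t → Bool, acceptProbAux U acc Cs (hist ++ [b]) (C.run U (initState t ψ) b)

/-- Probability that the procedure, run with black-box operator `U`, accepts the (possibly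
unnormalized) input state `ψ`. -/
def QProcedure.acceptProb (A : QProcedure) (U : Module.End ℂ E) (ψ : E) : ℝ :=
  acceptProbAux U A.accepts A.rounds [] ψ

/-- Total number of applications of the controlled black-box operator. -/
def QProcedure.controlledUCount (A : QProcedure) : ℕ :=
  (A.rounds.map QCircuit.controlledUCount).sum

/-! ### Phase estimation and the procedure Detect -/

/-- Number of ancilla qubits for phase estimation with precision `Δ`: the least `t` with
`2 ^ t ≥ 2 * π / Δ`. For an eigenvalue `e^{iα}`, the estimate of `α` is then, with probability
at least `8 / π ^ 2 ≥ 2 / 3`, one of the two multiples of `2 * π / 2 ^ t ≤ Δ` next to `α`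
(modulo `2 * π`). -/
def precisionBits (Δ : ℝ) : ℕ := ⌈Real.logb 2 (2 * Real.pi / Δ)⌉₊

/-- The textbook phase estimation circuit with `t` ancilla qubits: Hadamard gates on all ancilla
qubits, then `U ^ (2 ^ q)` controlled by qubit `q` for every `q`, then the inverse quantum Fourier
transform. -/
def phaseEstimationCircuit (t : ℕ) : QCircuit t :=
  (List.finRange t).map QGate.hadamard ++
    (List.finRange t).flatMap (fun q : Fin t => List.replicate (2 ^ (q : ℕ)) (QGate.controlledU q)) ++
    [QGate.inverseQFT]

/-- The estimated phase in `(-π, π]` belonging to a measurement outcome. -/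
def estimatedPhase {t : ℕ} (b : Fin t → Bool) : ℝ :=
  if 2 * bitsValue b ≤ 2 ^ t then 2 * Real.pi * bitsValue b / 2 ^ t
  else 2 * Real.pi * bitsValue b / 2 ^ t - 2 * Real.pi

/-- The procedure Detect with precision `Δ` and error parameter `ε`: apply phase estimation with
precision `Δ` to the same state `⌈c * log (1 / ε)⌉` times, and accept if at least one of the
estimated phases is nonzero. -/
def detect (c Δ ε : ℝ) : QProcedure where
  t := precisionBits Δ
  rounds := List.replicate ⌈c * Real.log (1 / ε)⌉₊ (phaseEstimationCircuit (precisionBits Δ))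
  accepts := fun outcomes => ∃ b ∈ outcomes, estimatedPhase b ≠ 0

/-! ### The random variable QH -/

/-- The value of QH on the eigenvalue `z = e^{iα}`, `α ∈ (-π, π]`: `1 / |α|` if `α ≠ 0`,
and `0` if `α = 0`. -/
def qhValue (z : ℂ) : ℝ := if z = 1 then 0 else 1 / |Complex.arg z|

variable [FiniteDimensional ℂ E]

open Classical in
/-- `Pr [QH > y]` for the unitary `U` and the state `ψ`: the eigenvalue `z` of `U` has as its
weight the squared norm of the orthogonal projection of `ψ` to the eigenspace of `z`. (If `U` and
`ψ` are real, conjugate eigenvalues `e^{iα_j}`, `e^{-iα_j}` have the same weight `δ_j ^ 2` and the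
same QH value `1 / α_j`, which therefore is taken with probability `2 * δ_j ^ 2`.) -/
def qhTail (U : Module.End ℂ E) (ψ : E) (y : ℝ) : ℝ :=
  ∑ z : Module.End.Eigenvalues U,
    if y < qhValue (z : ℂ) then ‖(Module.End.eigenspace U (z : ℂ)).starProjection ψ‖ ^ 2 else 0

/-- `min {y ≥ 0 : Pr [QH > y] ≤ ε}`. -/
def epsHittingTime (U : Module.End ℂ E) (ψ : E) (ε : ℝ) : ℝ :=
  sInf {y : ℝ | 0 ≤ y ∧ qhTail U ψ y ≤ ε}

open Classical in
/-- The minimum in the definition of `epsHittingTime` is attained. -/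
theorem epsHittingTime_isLeast (U : Module.End ℂ E) (ψ : E) (ε : ℝ) (hε : 0 < ε) :
    IsLeast {y : ℝ | 0 ≤ y ∧ qhTail U ψ y ≤ ε} (epsHittingTime U ψ ε) := by
  let F : Finset ℝ := insert 0 (Finset.univ.image fun z : Module.End.Eigenvalues U => qhValue (z : ℂ))
  have hval : ∀ z : ℂ, 0 ≤ qhValue z := by
    intro z
    unfold qhValue
    split_ifs <;> positivity
  have hF0 : ∀ f ∈ F, 0 ≤ f := by
    intro f hf
    rcases Finset.mem_insert.1 hf with rfl | hf
    · exact le_rfl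
    · obtain ⟨z, -, rfl⟩ := Finset.mem_image.1 hf
      exact hval _
  have key : ∀ y, 0 ≤ y → qhTail U ψ y ≤ ε → ∃ f ∈ F, f ≤ y ∧ qhTail U ψ f ≤ ε := by
    intro y hy h
    have hne : (F.filter (· ≤ y)).Nonempty := ⟨0, by simp [F, hy]⟩
    obtain ⟨f, hf, hmax⟩ := (F.filter (· ≤ y)).exists_max_image id hne
    rw [Finset.mem_filter] at hf
    refine ⟨f, hf.1, hf.2, le_trans (le_of_eq ?_) h⟩
    unfold qhTail
    refine Finset.sum_congr rfl fun z _ => ?_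
    have hz : f < qhValue (z : ℂ) ↔ y < qhValue (z : ℂ) := by
      refine ⟨fun h1 => ?_, fun h1 => lt_of_le_of_lt hf.2 h1⟩
      by_contra h2
      have := hmax (qhValue (z : ℂ)) (by simp [F, not_lt.1 h2])
      exact absurd h1 (not_lt.2 this)
    simp only [hz]
  have hne : (F.filter fun f => qhTail U ψ f ≤ ε).Nonempty := by
    obtain ⟨f, hf, hmax⟩ := F.exists_max_image id ⟨0, by simp [F]⟩
    refine ⟨f, Finset.mem_filter.2 ⟨hf, ?_⟩⟩
    have : qhTail U ψ f = 0 := by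
      unfold qhTail
      refine Finset.sum_eq_zero fun z _ => if_neg (not_lt.2 ?_)
      exact hmax (qhValue (z : ℂ)) (by simp [F])
    rw [this]
    exact hε.le
  obtain ⟨m, hm, hmin⟩ := (F.filter fun f => qhTail U ψ f ≤ ε).exists_min_image id hne
  rw [Finset.mem_filter] at hm
  have hleast : IsLeast {y : ℝ | 0 ≤ y ∧ qhTail U ψ y ≤ ε} m := by
    refine ⟨⟨hF0 m hm.1, hm.2⟩, ?_⟩
    rintro y ⟨hy, h⟩
    obtain ⟨f, hf, hfy, hft⟩ := key y hy h
    exact le_trans (hmin f (Finset.mem_filter.2 ⟨hf, hft⟩)) hfy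
  have : epsHittingTime U ψ ε = m := hleast.csInf_eq
  rw [this]
  exact hleast

end Semantics

/-! ### Abstract search -/

section Search

variable {ι : Type*} [Fintype ι] [DecidableEq ι]

/-- A real vector, viewed as a complex vector. -/
def complexify (v : EuclideanSpace ℝ ι) : EuclideanSpace ℂ ι :=
  WithLp.toLp 2 fun x => (v x : ℂ)

/-- The operator `U = U₂ U₁`, `U₁ = I - 2 |μ⟩⟨μ|`, on the complex Euclidean space. -/
def searchOperator (U₂ : Matrix ι ι ℝ) (μ : EuclideanSpace ℝ ι) :
    Module.End ℂ (EuclideanSpace ℂ ι) :=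
  Matrix.toEuclideanLin
    ((U₂ * (1 - (2 : ℝ) • Matrix.vecMulVec (fun x => μ x) (fun x => μ x))).map Complex.ofReal)

/-- The initial vector `φ₀ - ⟨μ|φ₀⟩ μ`. -/
def startVector (μ φ₀ : EuclideanSpace ℝ ι) : EuclideanSpace ℝ ι :=
  φ₀ - ⟪μ, φ₀⟫_ℝ • μ

/-- The quantum `ε`-error `μ`-hitting time of `U₂`, where `φ₀` is the `1`-eigenvector of `U₂`
(unique up to sign, which does not matter here). -/
def quantumHittingTime (U₂ : Matrix ι ι ℝ) (μ φ₀ : EuclideanSpace ℝ ι) (ε : ℝ) : ℝ :=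
  epsHittingTime (searchOperator U₂ μ) (complexify (startVector μ φ₀)) ε

end Search

end

/-! A round of phase estimation with outcome `0` leaves the system in A ψ, where A is the average of
the powers U ^ j, j < 2 ^ t: this is `powerAverage`. Only the outcome `0` is read as phase zero, so
k rounds reject exactly along the branch A ^ k ψ. All other branches accept and each round preserves
total norm, so the acceptance probability is ‖ψ‖ ^ 2 - ‖A ^ k ψ‖ ^ 2 (`acceptProb_detect`).

If φ₀ ⟂ μ, the start vector is φ₀, which U and hence A fix, so this difference is 0. Otherwise U has
no eigenvalue 1 (`eigenspace_searchOperator_one`). Decompose ψ over the orthogonal eigenspaces of U: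
on e^{iα}, A is a scalar of modulus at most 1, and at most 1/2 once 2 ^ t * |α| ≥ 2π
(`norm_sum_pow_le_half`). As 2 ^ t ≥ 2πT, this covers all phases with 1/|α| ≤ T; the slower ones
have total weight at most ε because T is at least the hitting time. Hence ‖A ^ k ψ‖ ^ 2 ≤ ε + 4 ^
(-k) ≤ 2ε (`norm_sq_powerAverage_pow_le`, `quarter_pow_ceil_le`). The cost is k * (2 ^ t - 1), with
2 ^ t ≤ 4πT. -/

/-! ### Bit strings as integers -/

section BitStrings

theorem bitsValue_eq_sum {t : ℕ} (b : Fin t → Bool) :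
    bitsValue b = ∑ i ∈ (Finset.univ.filter fun j => b j = true).map Fin.valEmbedding, 2 ^ i := by
  rw [Finset.sum_map, Finset.sum_filter]
  rfl

theorem bitsValue_lt {t : ℕ} (b : Fin t → Bool) : bitsValue b < 2 ^ t := by
  rw [bitsValue_eq_sum]
  refine Nat.geomSum_lt le_rfl fun k hk => ?_
  obtain ⟨j, -, rfl⟩ := Finset.mem_map.1 hk
  exact j.2

theorem bitsValue_injective {t : ℕ} : Function.Injective (bitsValue (t := t)) := by
  intro b b' h
  rw [bitsValue_eq_sum, bitsValue_eq_sum] at h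
  have h2 := Finset.map_injective _ (Finset.geomSum_injective le_rfl h)
  funext j
  have := congrArg (j ∈ ·) h2
  simp only [Finset.mem_filter, Finset.mem_univ, true_and] at this
  exact Bool.eq_iff_iff.2 (iff_of_eq this)

theorem bitsValue_zero {t : ℕ} : bitsValue (fun _ : Fin t => false) = 0 := by
  simp [bitsValue]

theorem sum_bitsValue {t : ℕ} {M : Type*} [AddCommMonoid M] (f : ℕ → M) :
    ∑ b : Fin t → Bool, f (bitsValue b) = ∑ k ∈ Finset.range (2 ^ t), f k := by
  have himage : Finset.univ.image (bitsValue (t := t)) = Finset.range (2 ^ t) := by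
    refine Finset.eq_of_subset_of_card_le (fun k hk => ?_) ?_
    · obtain ⟨b, -, rfl⟩ := Finset.mem_image.1 hk
      exact Finset.mem_range.2 (bitsValue_lt b)
    · rw [Finset.card_image_of_injective _ bitsValue_injective]
      simp
  rw [← himage, Finset.sum_image bitsValue_injective.injOn]

/-- Since `bitsValue b < 2 ^ t`, the branch that subtracts 2π is strictly negative, so reduction
modulo 2π creates no further zero. -/
theorem estimatedPhase_ne_zero_iff {t : ℕ} (b : Fin t → Bool) :
    estimatedPhase b ≠ 0 ↔ b ≠ fun _ => false := by
  rw [not_iff_not]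
  have hN : (0 : ℝ) < 2 ^ t := by positivity
  constructor
  · intro h
    apply bitsValue_injective
    rw [bitsValue_zero]
    unfold estimatedPhase at h
    have hlt : (bitsValue b : ℝ) < 2 ^ t := by exact_mod_cast bitsValue_lt b
    split_ifs at h with hb
    · rw [div_eq_zero_iff] at h
      have := Real.pi_pos.ne'
      have := hN.ne'
      simp_all
    · have : 2 * Real.pi * bitsValue b / 2 ^ t < 2 * Real.pi := by
        rw [div_lt_iff₀ hN]
        have := Real.pi_pos
        gcongr
      linarith
  · rintro rfl
    simp [estimatedPhase, bitsValue_zero]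

end BitStrings

/-! ### The phase estimation circuit and the acceptance probability of `detect` -/

section PhaseEstimation

variable {E : Type*} [NormedAddCommGroup E] [InnerProductSpace ℂ E]

theorem QCircuit.run_append {t : ℕ} (U : Module.End ℂ E) (C D : QCircuit t) (s : JointState t E) :
    QCircuit.run U (C ++ D) s = QCircuit.run U D (QCircuit.run U C s) := by
  induction C generalizing s with
  | nil => rfl
  | cons g C ih => exact ih _

open Classical in
/-- Hadamard gates on a list of distinct qubits `l`, applied when the qubits of `S` are in uniform
superposition and the others are `0`. -/
theorem run_hadamards_aux {t : ℕ} (U : Module.End ℂ E) (ψ : E) (l : List (Fin t)) (hl : l.Nodup)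
    (S : Finset (Fin t)) (hS : ∀ q ∈ l, q ∉ S) :
    QCircuit.run U (l.map QGate.hadamard)
        (fun b => if ∀ q ∉ S, b q = false then (((1 / Real.sqrt 2 : ℝ) : ℂ) ^ S.card) • ψ else 0) =
      fun b => if ∀ q ∉ S ∪ l.toFinset, b q = false then
        (((1 / Real.sqrt 2 : ℝ) : ℂ) ^ (S.card + l.length)) • ψ else 0 := by
  induction l generalizing S with
  | nil => simp [QCircuit.run]
  | cons q l ih =>
    have hq : q ∉ S := hS q (by simp)
    have hstep : (QGate.hadamard q).apply U
        (fun b => if ∀ q ∉ S, b q = false then (((1 / Real.sqrt 2 : ℝ) : ℂ) ^ S.card) • ψ else 0) =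
        fun b => if ∀ r ∉ insert q S, b r = false then
          (((1 / Real.sqrt 2 : ℝ) : ℂ) ^ (insert q S).card) • ψ else 0 := by
      funext b
      -- Qubit `q` is still `0`, so the component with bit `q` set vanishes and the Hadamard sign
      -- never matters.
      have h1 : ¬ ∀ r ∉ S, Function.update b q true r = false := fun h => by simpa using h q hq
      have h2 : (∀ r ∉ S, Function.update b q false r = false) ↔
          ∀ r ∉ insert q S, b r = false := by
        constructor
        · intro h r hr
          rw [Finset.mem_insert, not_or] at hr
          simpa [Function.update_of_ne hr.1] using h r hr.2
        · intro h r hr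
          by_cases hrq : r = q
          · subst hrq; simp
          · rw [Function.update_of_ne hrq]
            exact h r (by simp [hrq, hr])
      simp only [QGate.apply, h1, if_false, smul_zero, add_zero]
      rw [Finset.card_insert_of_notMem hq]
      by_cases h : ∀ r ∉ insert q S, b r = false
      · rw [if_pos (h2.2 h), if_pos h, smul_smul, pow_succ']
      · rw [if_neg (mt h2.1 h), if_neg h, smul_zero]
    rw [List.map_cons, QCircuit.run, hstep,
      ih (List.nodup_cons.1 hl).2 (insert q S) fun r hr => ?_]
    · funext b
      have : insert q S ∪ l.toFinset = S ∪ (q :: l).toFinset := by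
        ext; simp only [Finset.mem_union, Finset.mem_insert, List.toFinset_cons]; tauto
      rw [this, Finset.card_insert_of_notMem hq, List.length_cons, add_right_comm, add_assoc]
    · rw [Finset.mem_insert, not_or]
      exact ⟨fun h => (List.nodup_cons.1 hl).1 (h ▸ hr), hS r (by simp [hr])⟩

theorem run_hadamards {t : ℕ} (U : Module.End ℂ E) (ψ : E) :
    QCircuit.run U ((List.finRange t).map QGate.hadamard) (initState t ψ) =
      fun _ => ((1 / Real.sqrt 2 : ℝ) : ℂ) ^ t • ψ := by
  have h := run_hadamards_aux U ψ (List.finRange t) (List.nodup_finRange t) ∅ (by simp)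
  have h0 : initState t ψ = fun b : Fin t → Bool =>
      if ∀ q ∉ (∅ : Finset (Fin t)), b q = false then
        (((1 / Real.sqrt 2 : ℝ) : ℂ) ^ (∅ : Finset (Fin t)).card) • ψ else 0 := by
    funext b
    simp [initState, funext_iff]
  rw [h0]
  refine h.trans ?_
  funext b
  simp

theorem run_replicate_controlledU {t : ℕ} (U : Module.End ℂ E) (q : Fin t) (n : ℕ)
    (s : JointState t E) :
    QCircuit.run U (List.replicate n (QGate.controlledU q)) s =
      fun b => (U ^ (if b q then n else 0)) (s b) := by
  induction n generalizing s with
  | zero => funext b; simp [QCircuit.run]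
  | succ n ih =>
    rw [List.replicate_succ, QCircuit.run, ih]
    funext b
    by_cases h : b q <;> simp [QGate.apply, h, pow_succ]

theorem run_controlledU_powers {t : ℕ} (U : Module.End ℂ E) (l : List (Fin t))
    (s : JointState t E) :
    QCircuit.run U
        (l.flatMap fun q : Fin t => List.replicate (2 ^ (q : ℕ)) (QGate.controlledU q)) s =
      fun b => (U ^ (l.map fun q : Fin t => if b q then 2 ^ (q : ℕ) else 0).sum) (s b) := by
  induction l generalizing s with
  | nil => funext b; simp [QCircuit.run]
  | cons q l ih =>
    rw [List.flatMap_cons, QCircuit.run_append, run_replicate_controlledU, ih]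
    funext b
    rw [List.map_cons, List.sum_cons, add_comm, pow_add]
    rfl

theorem run_phaseEstimationCircuit {t : ℕ} (U : Module.End ℂ E) (ψ : E) :
    QCircuit.run U (phaseEstimationCircuit t) (initState t ψ) =
      QGate.inverseQFT.apply U
        fun b => (U ^ bitsValue b) (((1 / Real.sqrt 2 : ℝ) : ℂ) ^ t • ψ) := by
  rw [phaseEstimationCircuit, QCircuit.run_append, QCircuit.run_append, run_hadamards,
    run_controlledU_powers]
  have : ∀ b : Fin t → Bool,
      ((List.finRange t).map fun q : Fin t => if b q then 2 ^ (q : ℕ) else 0).sum =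
        bitsValue b := by
    intro b
    rw [bitsValue, ← List.ofFn_eq_map, List.sum_ofFn]
  simp only [this]
  rfl

theorem sum_exp_two_pi_eq_zero {N : ℕ} (hN : 0 < N) {m : ℤ} (hm : ¬ (N : ℤ) ∣ m) :
    ∑ k ∈ Finset.range N, Complex.exp (2 * Real.pi * Complex.I * k * m / N) = 0 := by
  have hN' : (N : ℂ) ≠ 0 := by exact_mod_cast hN.ne'
  have hpow : ∀ k : ℕ, Complex.exp (2 * Real.pi * Complex.I * k * m / N) =
      Complex.exp (2 * Real.pi * Complex.I * m / N) ^ k := by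
    intro k
    rw [← Complex.exp_nat_mul]
    ring_nf
  have hne : Complex.exp (2 * Real.pi * Complex.I * m / N) ≠ 1 := by
    rw [Ne, Complex.exp_eq_one_iff]
    rintro ⟨n, hn⟩
    apply hm
    refine ⟨n, ?_⟩
    have h2 : (2 * Real.pi * Complex.I : ℂ) ≠ 0 := Complex.two_pi_I_ne_zero
    rw [div_eq_iff hN'] at hn
    have : (m : ℂ) = N * n := mul_left_cancel₀ h2 (by rw [hn]; ring)
    exact_mod_cast this
  have hone : Complex.exp (2 * Real.pi * Complex.I * m / N) ^ N = 1 := by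
    rw [← Complex.exp_nat_mul, Complex.exp_eq_one_iff]
    exact ⟨m, by field_simp⟩
  simp only [hpow]
  rw [geom_sum_eq hne, hone, sub_self, zero_div]

/-- Parseval for `E`-valued functions: expand the squared norms as inner products and use
orthogonality of the characters of ℤ/2^t (`hchar`). -/
theorem sum_norm_sq_inverseQFT {t : ℕ} (U : Module.End ℂ E) (s : JointState t E) :
    ∑ b, ‖QGate.inverseQFT.apply U s b‖ ^ 2 = ∑ b, ‖s b‖ ^ 2 := by
  classical
  have hchar : ∀ b' b'' : Fin t → Bool, ∑ b : Fin t → Bool,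
      (starRingEnd ℂ) (Complex.exp (-(2 * Real.pi * Complex.I * (bitsValue b : ℂ) *
          (bitsValue b' : ℂ) / 2 ^ t))) *
        Complex.exp (-(2 * Real.pi * Complex.I * (bitsValue b : ℂ) * (bitsValue b'' : ℂ) / 2 ^ t)) =
      if b' = b'' then (2 : ℂ) ^ t else 0 := by
    intro b' b''
    have hterm : ∀ b : Fin t → Bool,
        (starRingEnd ℂ) (Complex.exp (-(2 * Real.pi * Complex.I * (bitsValue b : ℂ) *
          (bitsValue b' : ℂ) / 2 ^ t))) *
        Complex.exp (-(2 * Real.pi * Complex.I * (bitsValue b : ℂ) * (bitsValue b'' : ℂ) / 2 ^ t)) =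
        Complex.exp (2 * Real.pi * Complex.I * (bitsValue b : ℂ) *
          (((bitsValue b' : ℤ) - (bitsValue b'' : ℤ) : ℤ) : ℂ) / (2 ^ t : ℕ)) := by
      intro b
      rw [← Complex.exp_conj, ← Complex.exp_add]
      congr 1
      simp only [map_neg, map_div₀, map_mul, map_pow, Complex.conj_I, Complex.conj_ofReal,
        Complex.conj_natCast, Complex.conj_ofNat]
      push_cast
      ring
    simp only [hterm]
    rw [sum_bitsValue fun k => Complex.exp (2 * Real.pi * Complex.I * (k : ℂ) *
          (((bitsValue b' : ℤ) - (bitsValue b'' : ℤ) : ℤ) : ℂ) / (2 ^ t : ℕ))]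
    split_ifs with h
    · subst h
      simp
    · refine sum_exp_two_pi_eq_zero (by positivity) fun hdvd => h (bitsValue_injective ?_)
      have h1 := bitsValue_lt b'
      have h2 := bitsValue_lt b''
      have h3 := Int.eq_zero_of_abs_lt_dvd hdvd (by
        rw [abs_lt]; zify at h1 h2; constructor <;> push_cast <;> linarith)
      omega
  have hN : (0 : ℝ) < 2 ^ t := by positivity
  have key : ∑ b : Fin t → Bool, ‖∑ b' : Fin t → Bool,
      Complex.exp (-(2 * Real.pi * Complex.I * (bitsValue b : ℂ) * (bitsValue b' : ℂ) / 2 ^ t))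
        • s b'‖ ^ 2 = 2 ^ t * ∑ b, ‖s b‖ ^ 2 := by
    apply Complex.ofReal_injective
    push_cast
    have hn : ∀ v : E, (‖v‖ : ℂ) ^ 2 = ⟪v, v⟫_ℂ := fun v => (inner_self_eq_norm_sq_to_K v).symm
    simp only [hn, sum_inner, inner_sum, inner_smul_left, inner_smul_right]
    rw [Finset.sum_comm, Finset.mul_sum]
    refine Finset.sum_congr rfl fun b' _ => ?_
    simp only [Finset.mul_sum]
    rw [Finset.sum_comm]
    have hinner : ∀ b'' : Fin t → Bool, ∑ b : Fin t → Bool,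
        Complex.exp (-(2 * Real.pi * Complex.I * (bitsValue b : ℂ) * (bitsValue b' : ℂ) / 2 ^ t)) *
        ((starRingEnd ℂ) (Complex.exp (-(2 * Real.pi * Complex.I * (bitsValue b : ℂ) *
          (bitsValue b'' : ℂ) / 2 ^ t))) * ⟪s b'', s b'⟫_ℂ) =
        if b'' = b' then 2 ^ t * ⟪s b', s b'⟫_ℂ else 0 := by
      intro b''
      simp only [← mul_assoc, mul_comm (Complex.exp _) ((starRingEnd ℂ) _)]
      rw [← Finset.sum_mul, hchar]
      split_ifs with h
      · rw [h]
      · rw [zero_mul]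
    simp only [hinner, Finset.sum_ite_eq', Finset.mem_univ, if_true]
  simp only [QGate.apply, norm_smul, mul_pow]
  rw [← Finset.mul_sum, key, Complex.norm_real, Real.norm_eq_abs, sq_abs, div_pow,
    Real.sq_sqrt hN.le, ← mul_assoc]
  field_simp

/-- The average of the first `N` powers of an operator. -/
noncomputable def powerAverage (U : Module.End ℂ E) (N : ℕ) : Module.End ℂ E :=
  (N : ℂ)⁻¹ • ∑ k ∈ Finset.range N, U ^ k

/-- At outcome `0` all Fourier phases are 1. The Hadamards and the Fourier transform each contribute
2 ^ (-t/2), which gives the weight of an average. -/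
theorem run_phaseEstimationCircuit_zero {t : ℕ} (U : Module.End ℂ E) (ψ : E) :
    QCircuit.run U (phaseEstimationCircuit t) (initState t ψ) (fun _ => false) =
      powerAverage U (2 ^ t) ψ := by
  rw [run_phaseEstimationCircuit]
  simp only [QGate.apply, bitsValue_zero, map_smul, Nat.cast_zero, mul_zero, zero_mul, zero_div,
    neg_zero, Complex.exp_zero, one_smul]
  rw [← Finset.smul_sum, sum_bitsValue fun k => (U ^ k) ψ, smul_smul, powerAverage,
    LinearMap.smul_apply, LinearMap.sum_apply]
  congr 1
  rw [← Complex.ofReal_pow, ← Complex.ofReal_mul, div_pow, one_pow]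
  have h : Real.sqrt (2 ^ t) = Real.sqrt 2 ^ t := by
    rw [Real.sqrt_eq_iff_mul_self_eq (by positivity) (by positivity), ← mul_pow]
    simp
  have h2 : 1 / Real.sqrt 2 ^ t * (1 / Real.sqrt 2 ^ t) = ((2 : ℝ) ^ t)⁻¹ := by
    rw [div_mul_div_comm, ← mul_pow, Real.mul_self_sqrt (by norm_num), one_mul, one_div]
  rw [h, h2]
  push_cast
  rfl

theorem sum_norm_sq_run_phaseEstimationCircuit {t : ℕ} (U : Module.End ℂ E)
    (hU : ∀ v, ‖U v‖ = ‖v‖) (ψ : E) :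
    ∑ b, ‖QCircuit.run U (phaseEstimationCircuit t) (initState t ψ) b‖ ^ 2 = ‖ψ‖ ^ 2 := by
  have hpow : ∀ (k : ℕ) v, ‖(U ^ k) v‖ = ‖v‖ := by
    intro k
    induction k with
    | zero => simp
    | succ k ih => intro v; rw [pow_succ, Module.End.mul_apply, ih, hU]
  rw [run_phaseEstimationCircuit, sum_norm_sq_inverseQFT]
  simp only [hpow, norm_smul, norm_pow, Complex.norm_real, mul_pow]
  rw [Real.norm_eq_abs, ← pow_mul, mul_comm t 2, pow_mul, sq_abs, div_pow, Real.sq_sqrt (by norm_num)]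
  simp

-- Once a nonzero phase has been seen, acceptance is settled and the remaining rounds only
-- redistribute the norm.
open Classical in
theorem acceptProbAux_of_exists {t : ℕ} (U : Module.End ℂ E) (hU : ∀ v, ‖U v‖ = ‖v‖) (k : ℕ)
    (hist : List (Fin t → Bool)) (h : ∃ b ∈ hist, estimatedPhase b ≠ 0) (ψ : E) :
    acceptProbAux U (fun outcomes => ∃ b ∈ outcomes, estimatedPhase b ≠ 0)
      (List.replicate k (phaseEstimationCircuit t)) hist ψ = ‖ψ‖ ^ 2 := by
  induction k generalizing hist ψ with
  | zero => simp only [List.replicate_zero, acceptProbAux]; rw [if_pos h]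
  | succ k ih =>
    rw [List.replicate_succ, acceptProbAux, ← sum_norm_sq_run_phaseEstimationCircuit (t := t) U hU]
    refine Finset.sum_congr rfl fun b _ => ih _ ?_ _
    obtain ⟨b, hb, hb'⟩ := h
    exact ⟨b, by simp [hb], hb'⟩

-- Only the outcome `0` leaves the verdict open, and it applies the average once; every other
-- outcome keeps its full weight as accepted.
open Classical in
theorem acceptProbAux_of_forall {t : ℕ} (U : Module.End ℂ E) (hU : ∀ v, ‖U v‖ = ‖v‖) (k : ℕ)
    (hist : List (Fin t → Bool)) (h : ¬ ∃ b ∈ hist, estimatedPhase b ≠ 0) (ψ : E) :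
    acceptProbAux U (fun outcomes => ∃ b ∈ outcomes, estimatedPhase b ≠ 0)
      (List.replicate k (phaseEstimationCircuit t)) hist ψ =
        ‖ψ‖ ^ 2 - ‖(powerAverage U (2 ^ t) ^ k) ψ‖ ^ 2 := by
  induction k generalizing hist ψ with
  | zero => simp only [List.replicate_zero, acceptProbAux]; rw [if_neg h]; simp
  | succ k ih =>
    -- The outcome `0` is split off from both the acceptance sum and the norm sum; the remaining
    -- terms agree one by one.
    rw [List.replicate_succ, acceptProbAux, ← sum_norm_sq_run_phaseEstimationCircuit (t := t) U hU,
      ← Finset.add_sum_erase _ _ (Finset.mem_univ fun _ => false),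
      ← Finset.add_sum_erase _ _ (Finset.mem_univ fun _ => false), ih, add_sub_right_comm,
      run_phaseEstimationCircuit_zero, pow_succ (powerAverage U (2 ^ t)), Module.End.mul_apply]
    · congr 1
      refine Finset.sum_congr rfl fun b hb => acceptProbAux_of_exists U hU k _ ?_ _
      exact ⟨b, by simp, (estimatedPhase_ne_zero_iff b).2 (Finset.ne_of_mem_erase hb)⟩
    · rintro ⟨b, hb, hb'⟩
      rcases List.mem_append.1 hb with hb | hb
      · exact h ⟨b, hb, hb'⟩
      · exact (estimatedPhase_ne_zero_iff b).1 hb' (List.mem_singleton.1 hb)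

theorem acceptProb_detect (U : Module.End ℂ E) (hU : ∀ v, ‖U v‖ = ‖v‖) (c Δ ε : ℝ) (ψ : E) :
    (detect c Δ ε).acceptProb U ψ = ‖ψ‖ ^ 2 -
      ‖(powerAverage U (2 ^ precisionBits Δ) ^ ⌈c * Real.log (1 / ε)⌉₊) ψ‖ ^ 2 :=
  acceptProbAux_of_forall U hU _ [] (by simp) ψ

theorem controlledUCount_phaseEstimationCircuit (t : ℕ) :
    (phaseEstimationCircuit t).controlledUCount = 2 ^ t - 1 := by
  have h : ((List.finRange t).map fun q : Fin t => 2 ^ (q : ℕ)).sum = 2 ^ t - 1 := by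
    rw [← List.ofFn_eq_map, List.sum_ofFn, Fin.sum_univ_eq_sum_range fun i => 2 ^ i,
      Nat.geomSum_eq le_rfl]
    simp
  simp only [QCircuit.controlledUCount, phaseEstimationCircuit, List.map_append, List.sum_append,
    List.map_map, List.flatMap]
  simp [Function.comp_def, QGate.cost, h]

theorem controlledUCount_detect (c Δ ε : ℝ) :
    (detect c Δ ε).controlledUCount =
      ⌈c * Real.log (1 / ε)⌉₊ * (2 ^ precisionBits Δ - 1) := by
  simp [QProcedure.controlledUCount, detect, controlledUCount_phaseEstimationCircuit]

end PhaseEstimation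

/-! ### Spectral decomposition of an isometry and damping by averages -/

section Spectral

variable {E : Type*} [NormedAddCommGroup E] [InnerProductSpace ℂ E]

/-- The average is (z ^ N - 1) / (N (z - 1)). The numerator is at most 2 in modulus, and the chord
bound ‖z - 1‖ ≥ (2/π) |arg z| makes the denominator at least 4. -/
theorem norm_sum_pow_le_half {z : ℂ} (hz : ‖z‖ = 1) {N : ℕ}
    (hN : 2 * Real.pi ≤ N * |Complex.arg z|) :
    ‖(N : ℂ)⁻¹ * ∑ k ∈ Finset.range N, z ^ k‖ ≤ 1 / 2 := by
  have hpi := Real.pi_pos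
  have hz1 : z ≠ 1 := by
    rintro rfl
    simp at hN
    linarith
  have hz0 : z ≠ 0 := by rintro rfl; simp at hz
  have hNpos : (0 : ℝ) < N := by
    rcases Nat.eq_zero_or_pos N with rfl | h
    · simp at hN; linarith
    · exact_mod_cast h
  have h1 := Complex.mul_angle_le_norm_sub hz (norm_one (α := ℂ))
  rw [Complex.angle_one_right hz0] at h1
  have h2 : 4 ≤ N * ‖z - 1‖ := by
    calc (4 : ℝ) = 2 / Real.pi * (2 * Real.pi) := by field_simp; norm_num
      _ ≤ 2 / Real.pi * (N * |Complex.arg z|) := by gcongr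
      _ = N * (2 / Real.pi * |Complex.arg z|) := by ring
      _ ≤ N * ‖z - 1‖ := by gcongr
  have h3 : ‖z ^ N - 1‖ ≤ 2 := by
    refine (norm_sub_le _ _).trans ?_
    rw [norm_pow, hz]
    norm_num
  have h4 : 0 < ‖z - 1‖ := norm_pos_iff.2 (sub_ne_zero.2 hz1)
  rw [geom_sum_eq hz1, norm_mul, norm_div, norm_inv, Complex.norm_natCast, inv_mul_eq_div,
    div_div, div_le_iff₀ (by positivity)]
  linarith

theorem norm_sum_pow_le_one {z : ℂ} (hz : ‖z‖ = 1) (N : ℕ) :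
    ‖(N : ℂ)⁻¹ * ∑ k ∈ Finset.range N, z ^ k‖ ≤ 1 := by
  rw [norm_mul, norm_inv, Complex.norm_natCast]
  have : ‖∑ k ∈ Finset.range N, z ^ k‖ ≤ N := by
    refine (norm_sum_le _ _).trans ?_
    simp [hz]
  exact inv_mul_le_one_of_le₀ this (Nat.cast_nonneg _)

theorem pow_apply_of_mem_eigenspace {U : Module.End ℂ E} {z : ℂ} {v : E}
    (hv : v ∈ Module.End.eigenspace U z) (k : ℕ) : (U ^ k) v = z ^ k • v := by
  rw [Module.End.mem_eigenspace_iff] at hv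
  induction k with
  | zero => simp
  | succ k ih => rw [pow_succ, Module.End.mul_apply, hv, map_smul, ih, smul_smul, pow_succ']

theorem powerAverage_pow_apply {U : Module.End ℂ E} {z : ℂ} {v : E}
    (hv : v ∈ Module.End.eigenspace U z) (N k : ℕ) :
    (powerAverage U N ^ k) v = ((N : ℂ)⁻¹ * ∑ j ∈ Finset.range N, z ^ j) ^ k • v := by
  refine pow_apply_of_mem_eigenspace (Module.End.mem_eigenspace_iff.2 ?_) k
  rw [powerAverage, LinearMap.smul_apply, LinearMap.sum_apply, mul_smul, Finset.sum_smul]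
  simp only [pow_apply_of_mem_eigenspace hv]

theorem powerAverage_pow_apply_of_fixed {U : Module.End ℂ E} {v : E}
    (hv : v ∈ Module.End.eigenspace U 1) {N : ℕ} (hN : N ≠ 0) (k : ℕ) :
    (powerAverage U N ^ k) v = v := by
  have hN' : (N : ℂ) ≠ 0 := by exact_mod_cast hN
  rw [powerAverage_pow_apply hv]
  simp [hN']

theorem norm_eigenvalue_of_isometry {U : Module.End ℂ E} (hU : ∀ v, ‖U v‖ = ‖v‖) {z : ℂ}
    (hz : U.HasEigenvalue z) : ‖z‖ = 1 := by
  obtain ⟨v, hv⟩ := hz.exists_hasEigenvector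
  have h := hU v
  rw [hv.apply_eq_smul, norm_smul] at h
  exact (mul_eq_right₀ (norm_ne_zero_iff.2 hv.2)).1 h

/-- Preservation of ⟪v, u⟫ ≠ 0 would force conj z * w = 1, and |z| = 1 then gives z = w. -/
theorem orthogonalFamily_eigenspaces_of_isometry {U : Module.End ℂ E} (hU : ∀ v, ‖U v‖ = ‖v‖) :
    OrthogonalFamily ℂ (fun z : Module.End.Eigenvalues U => Module.End.eigenspace U (z : ℂ))
      fun z => (Module.End.eigenspace U (z : ℂ)).subtypeₗᵢ := by
  rintro z w hzw ⟨v, hv⟩ ⟨u, hu⟩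
  rw [Module.End.mem_eigenspace_iff] at hv hu
  have hinner : ⟪U v, U u⟫_ℂ = ⟪v, u⟫_ℂ := (LinearMap.norm_map_iff_inner_map_map U).1 hU v u
  rw [hv, hu, inner_smul_left, inner_smul_right, ← mul_assoc] at hinner
  by_contra hne
  refine hzw (Subtype.ext ?_)
  have h1 : (starRingEnd ℂ) (z : ℂ) * (w : ℂ) = 1 := (mul_eq_right₀ hne).1 hinner
  have h2 : (z : ℂ) * (starRingEnd ℂ) (z : ℂ) = 1 := by
    have hz : ‖(z : ℂ)‖ = 1 := norm_eigenvalue_of_isometry hU z.2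
    rw [Complex.mul_conj, Complex.normSq_eq_norm_sq, hz]
    norm_num
  calc (z : ℂ) = z * ((starRingEnd ℂ) (z : ℂ) * (w : ℂ)) := by rw [h1, mul_one]
    _ = w := by rw [← mul_assoc, h2, one_mul]

variable [FiniteDimensional ℂ E]

/-- The orthogonal complement of the span is U-invariant, because eigenvalues are nonzero; if
nontrivial, it would contain an eigenvector, which also lies in the span. -/
theorem iSup_eigenspaces_of_isometry {U : Module.End ℂ E} (hU : ∀ v, ‖U v‖ = ‖v‖) :
    ⨆ z : Module.End.Eigenvalues U, Module.End.eigenspace U (z : ℂ) = ⊤ := by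
  set W := ⨆ z : Module.End.Eigenvalues U, Module.End.eigenspace U (z : ℂ) with hW
  rw [← Submodule.orthogonal_eq_bot_iff]
  by_contra hne
  have hmaps : ∀ v ∈ Wᗮ, U v ∈ Wᗮ := by
    intro v hv
    rw [hW, Submodule.mem_orthogonal] at hv ⊢
    intro u hu
    induction hu using Submodule.iSup_induction' with
    | mem z u hu =>
      have hz : ‖(z : ℂ)‖ = 1 := norm_eigenvalue_of_isometry hU z.2
      have hz0 : (z : ℂ) ≠ 0 := by intro h; simp [h] at hz
      have hu' := Module.End.mem_eigenspace_iff.1 hu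
      have h0 : ⟪U u, U v⟫_ℂ = 0 := by
        rw [(LinearMap.norm_map_iff_inner_map_map U).1 hU u v]
        exact hv u (Submodule.mem_iSup_of_mem z hu)
      rw [hu', inner_smul_left] at h0
      exact (mul_eq_zero.1 h0).resolve_left (by simpa using hz0)
    | zero => simp
    | add x y _ _ hx hy => rw [inner_add_left, hx, hy, add_zero]
  have : Nontrivial Wᗮ := Submodule.nontrivial_iff_ne_bot.2 hne
  obtain ⟨z, hz⟩ := Module.End.exists_eigenvalue (U.restrict hmaps)
  obtain ⟨v, hv⟩ := hz.exists_hasEigenvector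
  have hv1 : U v = z • (v : E) := by
    have := congrArg Subtype.val hv.apply_eq_smul
    simpa using this
  have hv0 : (v : E) ≠ 0 := fun h => hv.2 (Subtype.ext h)
  have hzU : U.HasEigenvalue z :=
    Module.End.hasEigenvalue_of_hasEigenvector ⟨Module.End.mem_eigenspace_iff.2 hv1, hv0⟩
  have hvW : (v : E) ∈ W := Submodule.mem_iSup_of_mem (⟨z, hzU⟩ : Module.End.Eigenvalues U)
    (Module.End.mem_eigenspace_iff.2 hv1)
  exact hv0 (inner_self_eq_zero.1 (Submodule.inner_right_of_mem_orthogonal hvW v.2))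

/-- The squared norm of a combination of the spectral components of a vector. -/
theorem norm_sq_sum_smul_starProjection {U : Module.End ℂ E} (hU : ∀ v, ‖U v‖ = ‖v‖)
    (a : Module.End.Eigenvalues U → ℂ) (ψ : E) :
    ‖∑ z : Module.End.Eigenvalues U, a z • (Module.End.eigenspace U (z : ℂ)).starProjection ψ‖ ^ 2
      = ∑ z : Module.End.Eigenvalues U,
        ‖a z‖ ^ 2 * ‖(Module.End.eigenspace U (z : ℂ)).starProjection ψ‖ ^ 2 := by
  have h := (orthogonalFamily_eigenspaces_of_isometry hU).norm_sum
    (fun z => ⟨a z • (Module.End.eigenspace U (z : ℂ)).starProjection ψ,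
      Submodule.smul_mem _ _ (Submodule.starProjection_apply_mem _ _)⟩) Finset.univ
  simpa only [Submodule.coe_subtypeₗᵢ, Submodule.subtype_apply, Submodule.coe_norm, norm_smul,
    mul_pow] using h

theorem sum_starProjection_eigenspaces {U : Module.End ℂ E} (hU : ∀ v, ‖U v‖ = ‖v‖) (ψ : E) :
    ∑ z : Module.End.Eigenvalues U, (Module.End.eigenspace U (z : ℂ)).starProjection ψ = ψ :=
  (orthogonalFamily_eigenspaces_of_isometry hU).sum_projection_of_mem_iSup ψ
    (iSup_eigenspaces_of_isometry hU ▸ Submodule.mem_top)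

open Classical in
theorem qhTail_antitone (U : Module.End ℂ E) (ψ : E) : Antitone (qhTail U ψ) := by
  intro x y hxy
  refine Finset.sum_le_sum fun z _ => ?_
  split_ifs with h1 h2 h2
  · exact le_rfl
  · exact absurd (hxy.trans_lt h1) h2
  · positivity
  · exact le_rfl

open Classical in
/-- Without spectral component at `1`, repeated averaging over the powers of `U` damps everything
but the part of slow phases. -/
theorem norm_sq_powerAverage_pow_le {U : Module.End ℂ E} (hU : ∀ v, ‖U v‖ = ‖v‖)
    (h1 : Module.End.eigenspace U 1 = ⊥) {T : ℝ} {N : ℕ} (hN : 2 * Real.pi * T ≤ N)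
    (k : ℕ) (ψ : E) :
    ‖(powerAverage U N ^ k) ψ‖ ^ 2 ≤ qhTail U ψ T + (1 / 4) ^ k * ‖ψ‖ ^ 2 := by
  have hpi := Real.pi_pos
  have hψ : ‖ψ‖ ^ 2 = ∑ z : Module.End.Eigenvalues U,
      ‖(Module.End.eigenspace U (z : ℂ)).starProjection ψ‖ ^ 2 := by
    have := norm_sq_sum_smul_starProjection hU (fun _ => 1) ψ
    simpa only [one_smul, sum_starProjection_eigenspaces hU, norm_one, one_pow, one_mul] using this
  have hA : (powerAverage U N ^ k) ψ = ∑ z : Module.End.Eigenvalues U,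
      ((N : ℂ)⁻¹ * ∑ j ∈ Finset.range N, (z : ℂ) ^ j) ^ k •
        (Module.End.eigenspace U (z : ℂ)).starProjection ψ := by
    conv_lhs => rw [← sum_starProjection_eigenspaces hU ψ, map_sum]
    exact Finset.sum_congr rfl fun z _ =>
      powerAverage_pow_apply (Submodule.starProjection_apply_mem _ _) N k
  rw [hA, norm_sq_sum_smul_starProjection hU, hψ, qhTail, Finset.mul_sum,
    ← Finset.sum_add_distrib]
  refine Finset.sum_le_sum fun z _ => ?_
  have hz : ‖(z : ℂ)‖ = 1 := norm_eigenvalue_of_isometry hU z.2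
  rw [norm_pow]
  -- Slow phases are charged to `qhTail` with the trivial bound 1, fast phases to the factor (1/4) ^
  -- k.
  split_ifs with h
  · have : (‖(N : ℂ)⁻¹ * ∑ j ∈ Finset.range N, (z : ℂ) ^ j‖ ^ k) ^ 2 ≤ 1 :=
      pow_le_one₀ (by positivity) (pow_le_one₀ (norm_nonneg _) (norm_sum_pow_le_one hz N))
    have h2 := mul_le_mul_of_nonneg_right this
      (sq_nonneg ‖(Module.End.eigenspace U (z : ℂ)).starProjection ψ‖)
    have : 0 ≤ (1 / 4 : ℝ) ^ k * ‖(Module.End.eigenspace U (z : ℂ)).starProjection ψ‖ ^ 2 := by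
      positivity
    linarith
  -- `qhValue 1 = 0` would count the eigenvalue 1 as fast, although averaging does not damp it; `h1`
  -- excludes it.
  · have hz1 : (z : ℂ) ≠ 1 := by
      intro hz1
      have hz2 : Module.End.eigenspace U (z : ℂ) ≠ ⊥ := z.2
      exact hz2 (by rw [hz1, h1])
    have harg : 0 < |Complex.arg z| := by
      rw [abs_pos]
      intro h0
      apply hz1
      rw [← Complex.norm_mul_exp_arg_mul_I (z : ℂ), hz, h0]
      simp
    rw [qhValue, if_neg hz1, not_lt, div_le_iff₀ harg] at h
    have hle : 2 * Real.pi ≤ N * |Complex.arg z| := by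
      calc 2 * Real.pi = 2 * Real.pi * 1 := by ring
        _ ≤ 2 * Real.pi * (T * |Complex.arg z|) := by gcongr
        _ = 2 * Real.pi * T * |Complex.arg z| := by ring
        _ ≤ N * |Complex.arg z| := by gcongr
    rw [zero_add, ← pow_mul, mul_comm k 2, pow_mul]
    gcongr
    calc _ ≤ (1 / 2 : ℝ) ^ 2 := by gcongr; exact norm_sum_pow_le_half hz hle
      _ = 1 / 4 := by norm_num

end Spectral

/-! ### The search operator: unitarity and its fixed vectors -/

section SearchOperator

variable {ι : Type*} [Fintype ι]

theorem inner_complexify (v w : EuclideanSpace ℝ ι) :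
    ⟪complexify v, complexify w⟫_ℂ = (⟪v, w⟫_ℝ : ℂ) := by
  simp [complexify, PiLp.inner_apply]

theorem norm_complexify (v : EuclideanSpace ℝ ι) : ‖complexify v‖ = ‖v‖ := by
  simp [complexify, EuclideanSpace.norm_eq]

theorem norm_startVector_le {μ φ₀ : EuclideanSpace ℝ ι} (hμ : ‖μ‖ = 1) (hφ : ‖φ₀‖ = 1) :
    ‖startVector μ φ₀‖ ^ 2 ≤ 1 := by
  rw [startVector, norm_sub_sq_real, norm_smul, inner_smul_right, hμ, hφ, real_inner_comm φ₀ μ,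
    mul_one, Real.norm_eq_abs, sq_abs]
  nlinarith [sq_nonneg ⟪μ, φ₀⟫_ℝ]

variable [DecidableEq ι]

theorem toEuclideanLin_map_apply (A : Matrix ι ι ℝ) (v : EuclideanSpace ℝ ι) :
    Matrix.toEuclideanLin (A.map Complex.ofReal) (complexify v) =
      complexify (Matrix.toEuclideanLin A v) := by
  ext x
  simp [complexify, Matrix.toLpLin_apply, Matrix.mulVec, dotProduct]

theorem norm_toEuclideanLin_of_unitary {A : Matrix ι ι ℂ} (hA : A ∈ Matrix.unitaryGroup ι ℂ)
    (v : EuclideanSpace ℂ ι) : ‖Matrix.toEuclideanLin A v‖ = ‖v‖ := by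
  have h : ⟪Matrix.toEuclideanLin A v, Matrix.toEuclideanLin A v⟫_ℂ = ⟪v, v⟫_ℂ := by
    rw [← LinearMap.adjoint_inner_right, ← Matrix.toEuclideanLin_conjTranspose_eq_adjoint]
    have : Matrix.toEuclideanLin A.conjTranspose (Matrix.toEuclideanLin A v) = v := by
      ext x
      simp only [Matrix.toLpLin_apply, Matrix.mulVec_mulVec]
      rw [← Matrix.star_eq_conjTranspose, Matrix.mem_unitaryGroup_iff'.1 hA, Matrix.one_mulVec]
    rw [this]
  rw [inner_self_eq_norm_sq_to_K, inner_self_eq_norm_sq_to_K] at h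
  have h2 : ‖Matrix.toEuclideanLin A v‖ ^ 2 = ‖v‖ ^ 2 := by exact_mod_cast h
  exact (pow_left_inj₀ (norm_nonneg _) (norm_nonneg _) two_ne_zero).1 h2

theorem map_ofReal_mem_unitaryGroup {A : Matrix ι ι ℝ} (hA : A ∈ Matrix.orthogonalGroup ι ℝ) :
    A.map Complex.ofReal ∈ Matrix.unitaryGroup ι ℂ := by
  rw [Matrix.mem_unitaryGroup_iff']
  have h := congrArg (fun M : Matrix ι ι ℝ => M.map Complex.ofRealHom)
    (Matrix.mem_orthogonalGroup_iff' ι ℝ |>.1 hA)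
  simp only [Matrix.map_mul] at h
  rw [Matrix.map_one _ (map_zero _) (map_one _)] at h
  rw [← h]
  congr 1
  ext i j
  simp [Matrix.star_apply]

/-- For a unit vector the rank-one matrix V is a symmetric idempotent, so (1 - 2V) ^ 2 = 1 - 4V + 4V
= 1. -/
theorem reflection_mem_orthogonalGroup {μ : EuclideanSpace ℝ ι} (hμ : ‖μ‖ = 1) :
    (1 - (2 : ℝ) • Matrix.vecMulVec (fun x => μ x) (fun x => μ x)) ∈
      Matrix.orthogonalGroup ι ℝ := by
  rw [Matrix.mem_orthogonalGroup_iff']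
  have hsq : (fun x => μ x) ⬝ᵥ (fun x => μ x) = 1 := by
    have := EuclideanSpace.real_norm_sq_eq μ
    rw [hμ] at this
    simp only [dotProduct, ← sq]
    linarith
  have hV : Matrix.vecMulVec (fun x => μ x) (fun x => μ x) *
      Matrix.vecMulVec (fun x => μ x) (fun x => μ x) =
      Matrix.vecMulVec (fun x => μ x) (fun x => μ x) := by
    rw [Matrix.vecMulVec_mul_vecMulVec, hsq]
    simp
  have htr : (1 - (2 : ℝ) • Matrix.vecMulVec (fun x => μ x) (fun x => μ x)).transpose =
      1 - (2 : ℝ) • Matrix.vecMulVec (fun x => μ x) (fun x => μ x) := by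
    ext i j
    simp [Matrix.vecMulVec_apply, Matrix.one_apply, eq_comm, mul_comm]
  rw [htr, sub_mul, mul_sub, mul_sub, smul_mul_smul_comm, hV]
  simp only [one_mul, mul_one]
  module

theorem norm_searchOperator {U₂ : Matrix ι ι ℝ} (hU₂ : U₂ ∈ Matrix.orthogonalGroup ι ℝ)
    {μ : EuclideanSpace ℝ ι} (hμ : ‖μ‖ = 1) (v : EuclideanSpace ℂ ι) :
    ‖searchOperator U₂ μ v‖ = ‖v‖ :=
  norm_toEuclideanLin_of_unitary
    (map_ofReal_mem_unitaryGroup (mul_mem hU₂ (reflection_mem_orthogonalGroup hμ))) v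

theorem searchOperator_apply (U₂ : Matrix ι ι ℝ) (μ : EuclideanSpace ℝ ι)
    (v : EuclideanSpace ℂ ι) :
    searchOperator U₂ μ v = Matrix.toEuclideanLin (U₂.map Complex.ofReal)
      (v - (2 * ⟪complexify μ, v⟫_ℂ) • complexify μ) := by
  have hmap : (U₂ * (1 - (2 : ℝ) • Matrix.vecMulVec (fun x => μ x) (fun x => μ x))).map
      Complex.ofReal = U₂.map Complex.ofReal *
        (1 - (2 : ℂ) • Matrix.vecMulVec (complexify μ).ofLp (complexify μ).ofLp) := by
    change Matrix.map _ Complex.ofRealHom = Matrix.map _ Complex.ofRealHom * _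
    rw [Matrix.map_mul]
    congr 1
    ext i j
    by_cases h : i = j <;> simp [complexify, Matrix.vecMulVec_apply, h]
  rw [searchOperator, hmap]
  ext x
  simp only [Matrix.toLpLin_apply]
  rw [← Matrix.mulVec_mulVec]
  congr 2
  ext y
  have : ⟪complexify μ, v⟫_ℂ = (complexify μ).ofLp ⬝ᵥ v.ofLp := by
    simp [complexify, PiLp.inner_apply, dotProduct, mul_comm]
  rw [this]
  simp [Matrix.sub_mulVec, Matrix.smul_mulVec, Matrix.vecMulVec_mulVec]
  ring

/-- The eigenspace hypothesis is over ℝ. A real matrix fixes the real and imaginary parts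
separately, so each is a real multiple of φ₀. -/
theorem exists_smul_complexify_of_apply_eq {U₂ : Matrix ι ι ℝ} {φ₀ : EuclideanSpace ℝ ι}
    (h : Module.End.eigenspace (Matrix.toEuclideanLin U₂) 1 = Submodule.span ℝ {φ₀})
    {v : EuclideanSpace ℂ ι} (hv : Matrix.toEuclideanLin (U₂.map Complex.ofReal) v = v) :
    ∃ a : ℂ, v = a • complexify φ₀ := by
  have key : ∀ w : EuclideanSpace ℝ ι, Matrix.toEuclideanLin U₂ w = w → ∃ a : ℝ, a • φ₀ = w := by
    intro w hw
    rw [← Submodule.mem_span_singleton, ← h, Module.End.mem_eigenspace_iff, hw, one_smul]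
  obtain ⟨a, ha⟩ := key (WithLp.toLp 2 fun x => (v x).re) (by
    ext x
    have := congrArg Complex.re (congrFun (congrArg WithLp.ofLp hv) x)
    simpa [Matrix.toLpLin_apply, Matrix.mulVec, dotProduct] using this)
  obtain ⟨b, hb⟩ := key (WithLp.toLp 2 fun x => (v x).im) (by
    ext x
    have := congrArg Complex.im (congrFun (congrArg WithLp.ofLp hv) x)
    simpa [Matrix.toLpLin_apply, Matrix.mulVec, dotProduct] using this)
  refine ⟨⟨a, b⟩, ?_⟩
  ext x
  have h1 := congrFun (congrArg WithLp.ofLp ha) x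
  have h2 := congrFun (congrArg WithLp.ofLp hb) x
  simp only [PiLp.smul_apply, smul_eq_mul] at h1 h2
  apply Complex.ext <;> simp [complexify, ← h1, ← h2]

theorem toEuclideanLin_apply_of_eigenspace_eq {U₂ : Matrix ι ι ℝ} {φ₀ : EuclideanSpace ℝ ι}
    (h : Module.End.eigenspace (Matrix.toEuclideanLin U₂) 1 = Submodule.span ℝ {φ₀}) :
    Matrix.toEuclideanLin U₂ φ₀ = φ₀ := by
  have := h ▸ Submodule.mem_span_singleton_self φ₀
  rwa [Module.End.mem_eigenspace_iff, one_smul] at this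

/-- Pairing U v = v with φ₀ = U₂ φ₀ gives 2 ⟪μ, v⟫ ⟪φ₀, μ⟫ = 0, hence ⟪μ, v⟫ = 0. Then U₂ itself
fixes v, so v = a φ₀, and ⟪μ, v⟫ = 0 now forces a = 0. -/
theorem eigenspace_searchOperator_one {U₂ : Matrix ι ι ℝ} {μ φ₀ : EuclideanSpace ℝ ι}
    (hU₂ : U₂ ∈ Matrix.orthogonalGroup ι ℝ)
    (h : Module.End.eigenspace (Matrix.toEuclideanLin U₂) 1 = Submodule.span ℝ {φ₀})
    (hμφ : ⟪φ₀, μ⟫_ℝ ≠ 0) : Module.End.eigenspace (searchOperator U₂ μ) 1 = ⊥ := by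
  rw [Submodule.eq_bot_iff]
  intro v hv
  rw [Module.End.mem_eigenspace_iff, one_smul, searchOperator_apply] at hv
  have hφ : Matrix.toEuclideanLin (U₂.map Complex.ofReal) (complexify φ₀) = complexify φ₀ := by
    rw [toEuclideanLin_map_apply, toEuclideanLin_apply_of_eigenspace_eq h]
  have hinner := (LinearMap.norm_map_iff_inner_map_map
    (Matrix.toEuclideanLin (U₂.map Complex.ofReal))).1
    (norm_toEuclideanLin_of_unitary (map_ofReal_mem_unitaryGroup hU₂)) (complexify φ₀)
    (v - (2 * ⟪complexify μ, v⟫_ℂ) • complexify μ)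
  rw [hφ, hv, inner_sub_right, inner_smul_right, inner_complexify] at hinner
  have h0 : ⟪complexify μ, v⟫_ℂ = 0 := by
    have h1 : 2 * ⟪complexify μ, v⟫_ℂ * (⟪φ₀, μ⟫_ℝ : ℂ) = 0 := by linear_combination hinner
    have h2 : (⟪φ₀, μ⟫_ℝ : ℂ) ≠ 0 := by exact_mod_cast hμφ
    simpa [h2] using h1
  rw [h0, mul_zero, zero_smul, sub_zero] at hv
  obtain ⟨a, rfl⟩ := exists_smul_complexify_of_apply_eq h hv
  rw [inner_smul_right, inner_complexify, real_inner_comm] at h0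
  have ha : a = 0 := (mul_eq_zero.1 h0).resolve_right (by exact_mod_cast hμφ)
  rw [ha, zero_smul]

theorem searchOperator_startVector {U₂ : Matrix ι ι ℝ} {μ φ₀ : EuclideanSpace ℝ ι}
    (h : Module.End.eigenspace (Matrix.toEuclideanLin U₂) 1 = Submodule.span ℝ {φ₀})
    (hμφ : ⟪φ₀, μ⟫_ℝ = 0) :
    complexify (startVector μ φ₀) ∈ Module.End.eigenspace (searchOperator U₂ μ) 1 := by
  have hs : startVector μ φ₀ = φ₀ := by
    rw [startVector, real_inner_comm, hμφ, zero_smul, sub_zero]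
  rw [hs, Module.End.mem_eigenspace_iff, searchOperator_apply, inner_complexify,
    real_inner_comm, hμφ, Complex.ofReal_zero, mul_zero, zero_smul, sub_zero, one_smul,
    toEuclideanLin_map_apply, toEuclideanLin_apply_of_eigenspace_eq h]

end SearchOperator

/-! ### Number of ancilla qubits, number of rounds, cost -/

section Precision

theorem le_two_pow_precisionBits {T : ℝ} (hT : 0 < T) :
    2 * Real.pi * T ≤ (2 ^ precisionBits (1 / T) : ℕ) := by
  have hpos : 0 < 2 * Real.pi * T := by positivity
  have h : Real.logb 2 (2 * Real.pi * T) ≤ (precisionBits (1 / T) : ℝ) := by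
    rw [precisionBits, div_div_eq_mul_div, div_one]
    exact Nat.le_ceil _
  rw [Real.logb_le_iff_le_rpow (by norm_num) hpos, Real.rpow_natCast] at h
  exact_mod_cast h

theorem two_pow_precisionBits_le {T : ℝ} (hT : 1 ≤ T) :
    (2 : ℝ) ^ precisionBits (1 / T) ≤ 4 * Real.pi * T := by
  have hpi := Real.pi_gt_three
  -- The logarithm must be nonnegative for the natural-number ceiling to exceed it by at most 1,
  -- which costs a factor 2.
  have hge : 1 ≤ 2 * Real.pi * T := by nlinarith
  have h : (precisionBits (1 / T) : ℝ) ≤ Real.logb 2 (2 * Real.pi * T) + 1 := by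
    rw [precisionBits, div_div_eq_mul_div, div_one]
    exact (Nat.ceil_lt_add_one (Real.logb_nonneg (by norm_num) hge)).le
  rw [← Real.rpow_natCast]
  calc (2 : ℝ) ^ (precisionBits (1 / T) : ℝ) ≤ 2 ^ (Real.logb 2 (2 * Real.pi * T) + 1) :=
        Real.rpow_le_rpow_of_exponent_le (by norm_num) h
    _ = 4 * Real.pi * T := by
        rw [Real.rpow_add (by norm_num), Real.rpow_logb (by norm_num) (by norm_num) (by linarith),
          Real.rpow_one]
        ring

theorem quarter_pow_ceil_le {c ε : ℝ} (hc : 1 / Real.log 3 ≤ c) (hε : 0 < ε) (hε1 : ε < 1) :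
    (1 / 4 : ℝ) ^ ⌈c * Real.log (1 / ε)⌉₊ ≤ ε := by
  have h3 : 0 < Real.log 3 := Real.log_pos (by norm_num)
  have hL : 0 < Real.log (1 / ε) := Real.log_pos (by rw [lt_div_iff₀ hε]; linarith)
  have hcL : Real.log (1 / ε) ≤ Real.log 3 * (c * Real.log (1 / ε)) := by
    rw [div_le_iff₀ h3] at hc
    nlinarith
  set k := ⌈c * Real.log (1 / ε)⌉₊
  have hk : Real.log (1 / ε) ≤ k * Real.log 3 := by
    have := Nat.le_ceil (c * Real.log (1 / ε))
    nlinarith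
  -- Weakening 1/4 to 1/3 matches the assumption on `c`, which gives exactly k * log 3 ≥ log (1 /
  -- ε).
  calc (1 / 4 : ℝ) ^ k ≤ (1 / 3) ^ k := by gcongr; norm_num
    _ = Real.exp (-(k * Real.log 3)) := by
        rw [Real.exp_neg, Real.exp_nat_mul, Real.exp_log (by norm_num), one_div, inv_pow]
    _ ≤ Real.exp (-Real.log (1 / ε)) := Real.exp_le_exp.2 (neg_le_neg hk)
    _ = ε := by rw [one_div, Real.log_inv, neg_neg, Real.exp_log hε]

theorem controlledUCount_detect_le {c ε T : ℝ} (hc : 0 < c) (hε : 0 < ε) (hε1 : ε < 1)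
    (hT : 1 ≤ T) :
    ((detect c (1 / T) ε).controlledUCount : ℝ) ≤
      4 * Real.pi * (c * Real.log (1 / ε) + 1) * T := by
  have hL : 0 < Real.log (1 / ε) := Real.log_pos (by rw [lt_div_iff₀ hε]; linarith)
  rw [controlledUCount_detect]
  have h1 : (⌈c * Real.log (1 / ε)⌉₊ : ℝ) ≤ c * Real.log (1 / ε) + 1 :=
    (Nat.ceil_lt_add_one (by positivity)).le
  have h2 : ((2 ^ precisionBits (1 / T) - 1 : ℕ) : ℝ) ≤ 4 * Real.pi * T := by
    refine le_trans ?_ (two_pow_precisionBits_le hT)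
    exact_mod_cast Nat.sub_le _ _
  rw [Nat.cast_mul]
  calc _ ≤ (c * Real.log (1 / ε) + 1) * (4 * Real.pi * T) := by gcongr
    _ = _ := by ring

end Precision

/-! ### The main theorem -/

theorem mainTheorem7 (c : ℝ) (hc : 1 / Real.log 3 ≤ c) :
    ∃ K : ℝ, 0 < K ∧
      ∀ (ι : Type*) [Fintype ι] [DecidableEq ι]
        (U₂ : Matrix ι ι ℝ) (μ φ₀ : EuclideanSpace ℝ ι) (ε T : ℝ),
        U₂ ∈ Matrix.orthogonalGroup ι ℝ →
        ‖μ‖ = 1 →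
        ‖φ₀‖ = 1 →
        Module.End.eigenspace (Matrix.toEuclideanLin U₂) 1 = Submodule.span ℝ {φ₀} →
        0 < ε → ε < 1 →
        max 1 (quantumHittingTime U₂ μ φ₀ ε) ≤ T →
        (⟪φ₀, μ⟫_ℝ ≠ 0 →
          ‖startVector μ φ₀‖ ^ 2 - K * ε ≤
              (detect c (1 / T) ε).acceptProb (searchOperator U₂ μ)
                (complexify (startVector μ φ₀)) ∧
            (detect c (1 / T) ε).acceptProb (searchOperator U₂ μ)
                (complexify (startVector μ φ₀)) ≤ ‖startVector μ φ₀‖ ^ 2) ∧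
        (⟪φ₀, μ⟫_ℝ = 0 →
          (detect c (1 / T) ε).acceptProb (searchOperator U₂ μ)
            (complexify (startVector μ φ₀)) = 0) ∧
        ((detect c (1 / T) ε).controlledUCount : ℝ) ≤ K * (1 + Real.log (1 / ε)) * T ∧
        (ε ≤ 1 / 2 →
          ((detect c (1 / T) ε).controlledUCount : ℝ) ≤ K * Real.log (1 / ε) * T) := by
  have hpi := Real.pi_gt_three
  have hc0 : 0 < c := lt_of_lt_of_le (one_div_pos.2 (Real.log_pos (by norm_num))) hc
  -- 4π comes from 2 ^ t ≤ 4πT; c + 2 absorbs the rounding in c * L + 1 ≤ (c + 2) * L for L = log (1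
  -- / ε) ≥ 1/2. The product also exceeds the 2 needed for the error bound.
  refine ⟨4 * Real.pi * (c + 2), by positivity, ?_⟩
  intro ι _ _ U₂ μ φ₀ ε T hU₂ hμ hφ heig hε hε1 hmax
  have hT : 1 ≤ T := (le_max_left _ _).trans hmax
  have hT0 : 0 < T := by linarith
  have hL : 0 < Real.log (1 / ε) := Real.log_pos (by rw [lt_div_iff₀ hε]; linarith)
  have hiso := norm_searchOperator hU₂ hμ
  have hcount := controlledUCount_detect_le hc0 hε hε1 hT
  refine ⟨fun hne => ?_, fun h0 => ?_, ?_, fun hhalf => ?_⟩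
  · rw [acceptProb_detect _ hiso, norm_complexify]
    refine ⟨?_, sub_le_self _ (sq_nonneg _)⟩
    have hdamp := norm_sq_powerAverage_pow_le hiso (eigenspace_searchOperator_one hU₂ heig hne)
      (le_two_pow_precisionBits hT0) ⌈c * Real.log (1 / ε)⌉₊ (complexify (startVector μ φ₀))
    rw [norm_complexify] at hdamp
    -- The minimum is attained, so the tail is already at most ε at the hitting time itself;
    -- monotonicity carries this to T.
    have htail : qhTail (searchOperator U₂ μ) (complexify (startVector μ φ₀)) T ≤ ε :=
      (qhTail_antitone _ _ ((le_max_right _ _).trans hmax)).trans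
        (epsHittingTime_isLeast _ _ ε hε).1.2
    have hquarter := quarter_pow_ceil_le hc hε hε1
    have hnorm := norm_startVector_le hμ hφ
    have hprod := mul_le_mul hquarter hnorm (sq_nonneg _) hε.le
    have hK : 2 * ε ≤ 4 * Real.pi * (c + 2) * ε := by
      gcongr
      nlinarith
    linarith
  · have hfix := searchOperator_startVector heig h0
    rw [acceptProb_detect _ hiso,
      powerAverage_pow_apply_of_fixed hfix (by positivity), sub_self]
  · refine hcount.trans ?_
    rw [mul_assoc (4 * Real.pi) (c + 2)]
    gcongr
    nlinarith
  · refine hcount.trans ?_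
    have hlog : 1 / 2 ≤ Real.log (1 / ε) := by
      have h2 : Real.log 2 ≤ Real.log (1 / ε) :=
        Real.log_le_log (by norm_num) (by rw [le_div_iff₀ hε]; linarith)
      linarith [Real.log_two_gt_d9]
    rw [mul_assoc (4 * Real.pi) (c + 2)]
    gcongr
    nlinarith
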